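/- **Theorem (sample complexity lower bound).** A discounted MDP $M=(\mathcal S,\mathcal A,P,r,\gamma)$ has finite state and action sets, transition distributions $P(\cdot\mid s,a)$, rewards $r(s,a)\in[0,1]$ and a discount factor $\gamma\in(0,1)$. For a policy $\pi:\mathcal S\to\mathcal A$ let $v^\pi(s)=\mathbb E\big[\sum_{t\ge 0}\gamma^t r(s^t,\pi(s^t))\mid s^0=s\big]$ and let $v^*(s)=\max_\pi v^\pi(s)$. Let $\mathcal M^{trans}_K(\mathcal S,\mathcal A,\gamma)$ be the set of all such $M$ for which there are a feature map $\phi:\mathcal S\times\mathcal A\to\mathbb R^K$ and functions $\psi_1,\dots,\psi_K:\mathcal S\to\mathbb R$ with $P(s'\mid s,a)=\sum_{k=1}^K\phi_k(s,a)\psi_k(s')$ for all $s,a,s'$. An algorithm is a (possibly randomized) adaptive procedure which knows $\mathcal S,\mathcal A,\gamma,K,\varepsilon,N,r$ and $\phi$, but not $P$. It chooses one after the other $N$ state-action pairs, depending on what it has seen before, observes for each chosen pair $(s,a)$ an independent draw $s'\sim P(\cdot\mid s,a)$, and then outputs a policy $\pi^{\mathrm{alg},M,N}$. There is an absolute constant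 $c>0$, and for every $\gamma_0\in(0,1)$ there is $\varepsilon_0\in(0,1)$ depending only on $\gamma_0$, such that the following holds for all finite sets $\mathcal S,\mathcal A$ with $|\mathcal S|,|\mathcal A|\ge 2$, all integers $2\le K\le|\mathcal S||\mathcal A|$, all $\gamma\in[\gamma_0,1)$, all $\varepsilon\in(0,\varepsilon_0]$ and all integers $N\ge 0$ with $$N\le c\cdot\frac{K}{(1-\gamma)^3\,\varepsilon^2\,\log(1/\varepsilon)}.$$ For every algorithm there is an instance $M\in\mathcal M^{trans}_K(\mathcal S,\mathcal A,\gamma)$, with a feature map $\phi$ that represents it and is given to the algorithm, such that with probability at least $1/3$ the output is not $\varepsilon$-optimal: $$\mathbb P\Big(\sup_{s\in\mathcal S}\big(v^*(s)-v^{\pi^{\mathrm{alg},M,N}}(s)\big)>\varepsilon\Big)\ge\frac13 .$$ In particular $\inf_{\mathrm{alg}}\sup_{M\in\mathcal M^{trans}_K(\mathcal S,\mathcal A,\gamma)}\mathbb P\big(\sup_s(v^*(s)-v^{\pi^{\mathrm{alg},M,N}}(s))\ge\varepsilon\big)\ge 1/3$. -/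

import Mathlib

noncomputable section

/-- A discounted Markov decision process with state space `S` and action space `A`: transition
distributions `P`, rewards `r` in `[0, 1]` and a discount factor `γ ∈ (0, 1)`. -/
structure DMDP (S A : Type*) where
  P : S → A → PMF S
  r : S → A → ℝ
  γ : ℝ
  r_nonneg : ∀ s a, 0 ≤ r s a
  r_le_one : ∀ s a, r s a ≤ 1
  γ_pos : 0 < γ
  γ_lt_one : γ < 1

namespace DMDP

variable {S A : Type*}

/-- The law of the state `s^t` when policy `π` is played from the initial state `s^0 = s`. -/
def stateLaw (M : DMDP S A) (π : S → A) (s : S) : ℕ → PMF S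
  | 0 => PMF.pure s
  | t + 1 => (M.stateLaw π s t).bind fun x => M.P x (π x)

/-- The value function `v^π(s) = 𝔼[∑ t, γ^t r(s^t, π(s^t)) | s^0 = s]`, the expected reward of
each time step being computed from the law of `s^t`. -/
def value [Fintype S] (M : DMDP S A) (π : S → A) (s : S) : ℝ :=
  ∑' t : ℕ, M.γ ^ t * ∑ x : S, (M.stateLaw π s t x).toReal * M.r x (π x)

/-- The optimal value `v^*(s) = max_π v^π(s)`. -/
def optValue [Fintype S] (M : DMDP S A) (s : S) : ℝ :=
  ⨆ π : S → A, M.value π s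

/-- `sup_s (v^*(s) - v^π(s))`. -/
def subopt [Fintype S] (M : DMDP S A) (π : S → A) : ℝ :=
  ⨆ s : S, (M.optValue s - M.value π s)

/-- `M` admits the linear feature representation `φ`:
`P(s' | s, a) = ∑ k, φ_k(s, a) ψ_k(s')` for some real functions `ψ_k` on the states. -/
def AdmitsFeatures {K : ℕ} (M : DMDP S A) (φ : S → A → Fin K → ℝ) : Prop :=
  ∃ ψ : Fin K → S → ℝ, ∀ s a s', (M.P s a s').toReal = ∑ k, φ s a k * ψ k s'

/-- The class of all instances with discount factor `γ` that admit the representation `φ`. -/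
def featureClass {K : ℕ} (γ : ℝ) (φ : S → A → Fin K → ℝ) : Set (DMDP S A) :=
  {M | M.γ = γ ∧ M.AdmitsFeatures φ}

end DMDP

/-- A randomized adaptive algorithm with access to a generative model. It knows the reward
function and the feature map. Given the list of transitions `(s, a, s')` sampled so far (the most
recent one first), `query` is the law of the next state-action pair at which a transition is
sampled, and `output` is the law of the policy that is returned. -/
structure SamplingAlgorithm (S A : Type*) (K : ℕ) where
  query : (S → A → ℝ) → (S → A → Fin K → ℝ) → List (S × A × S) → PMF (S × A)
  output : (S → A → ℝ) → (S → A → Fin K → ℝ) → List (S × A × S) → PMF (S → A)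

namespace SamplingAlgorithm

variable {S A : Type*} {K : ℕ}

/-- The law of the first `n` sampled transitions when the algorithm runs on `M` with features
`φ`; the samples are fresh draws from `M.P`. -/
def transcript (alg : SamplingAlgorithm S A K) (M : DMDP S A) (φ : S → A → Fin K → ℝ) :
    ℕ → PMF (List (S × A × S))
  | 0 => PMF.pure []
  | n + 1 => (alg.transcript M φ n).bind fun h =>
      (alg.query M.r φ h).bind fun q =>
        (M.P q.1 q.2).map fun s' => (q.1, q.2, s') :: h

/-- The law of the policy returned by the algorithm after `N` samples. -/
def policyLaw (alg : SamplingAlgorithm S A K) (M : DMDP S A) (φ : S → A → Fin K → ℝ) (N : ℕ) :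
    PMF (S → A) :=
  (alg.transcript M φ N).bind fun h => alg.output M.r φ h

end SamplingAlgorithm

end

/-! The hard instances have an absorbing zero-reward state `y` and `m` pairs `(x i, a i)`, where `m`
is comparable to `K`. From any other state one either stays or falls into `y`, so values are
geometric series. Pair `i` stays with an unknown probability `θ i` and pays `ρ`; the reference
action `a₀` pays `1` and stays with `γ` times such a parameter. The reward `ρ` makes the two actions
tie when the parameter is `γ`, and moving it by `D`, of order `ε (1 - γ)² / γ`, opens a gap larger
than `ε` (`value_gap_low`, `value_gap_high`).

In the base instance every parameter is `γ - D`, and playing `a k` at `x k` is bad; in the `k`-th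
alternative `θ k` is `γ + D`, and not playing it is bad. Rewards and features are the same in all
instances. One sample of pair `k` carries chi-square information of order `D² / (γ (1 - γ))`, and
some `k` receives at most `N / m` expected samples, so an algorithm that succeeds on the base
instance fails on that alternative.

`exists_change_of_measure` is the statistical half, and `exists_instance_subopt_gt` joins it to the
construction. The argument needs no logarithm: the one in the statement only absorbs constants. -/

open scoped ENNReal

/-! ### Sums and events for probability mass functions -/

theorem PMF.tsum_bind_mul {α β : Type*} (p : PMF α) (f : α → PMF β) (g : β → ℝ≥0∞) :
    ∑' b, p.bind f b * g b = ∑' a, p a * ∑' b, f a b * g b := by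
  simp only [PMF.bind_apply, ← ENNReal.tsum_mul_right, ← ENNReal.tsum_mul_left]
  rw [ENNReal.tsum_comm]
  simp only [mul_assoc]

theorem PMF.tsum_map_mul {α β : Type*} (p : PMF α) (f : α → β) (g : β → ℝ≥0∞) :
    ∑' b, p.map f b * g b = ∑' a, p a * g (f a) := by
  rw [PMF.map, PMF.tsum_bind_mul]
  refine tsum_congr fun a => ?_
  rw [tsum_eq_single (f a) fun b hb => by simp [hb]]
  simp

theorem PMF.sum_toReal {α : Type*} [Fintype α] (p : PMF α) : ∑ a, (p a).toReal = 1 := by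
  have h := p.tsum_coe
  rw [tsum_fintype] at h
  rw [← ENNReal.toReal_sum fun a _ => p.apply_ne_top a, h, ENNReal.toReal_one]

theorem PMF.tsum_mul_ofReal {α : Type*} [Fintype α] (p : PMF α) {f : α → ℝ}
    (hf : ∀ a, 0 ≤ f a) :
    ∑' a, p a * ENNReal.ofReal (f a) = ENNReal.ofReal (∑ a, (p a).toReal * f a) := by
  rw [tsum_fintype, ENNReal.ofReal_sum_of_nonneg fun a _ => mul_nonneg ENNReal.toReal_nonneg (hf a)]
  refine Finset.sum_congr rfl fun a _ => ?_
  rw [ENNReal.ofReal_mul ENNReal.toReal_nonneg, ENNReal.ofReal_toReal (p.apply_ne_top a)]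

theorem PMF.toOuterMeasure_le_one {α : Type*} (p : PMF α) (B : Set α) :
    p.toOuterMeasure B ≤ 1 :=
  (p.toOuterMeasure.mono (Set.subset_univ B)).trans
    ((p.toOuterMeasure_apply_eq_one_iff _).2 (Set.subset_univ _)).le

theorem PMF.toOuterMeasure_add_compl {α : Type*} (p : PMF α) (B : Set α) :
    p.toOuterMeasure B + p.toOuterMeasure Bᶜ = 1 := by
  rw [PMF.toOuterMeasure_apply, PMF.toOuterMeasure_apply, ← ENNReal.tsum_add, ← p.tsum_coe]
  exact tsum_congr fun a => Set.indicator_self_add_compl_apply B p a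

theorem PMF.toReal_bind_apply {α β : Type*} [Fintype α] (p : PMF α) (f : α → PMF β) (b : β) :
    (p.bind f b).toReal = ∑ a, (p a).toReal * (f a b).toReal := by
  rw [PMF.bind_apply, tsum_fintype,
    ENNReal.toReal_sum fun a _ => ENNReal.mul_ne_top (p.apply_ne_top a) ((f a).apply_ne_top b)]
  simp only [ENNReal.toReal_mul]

/-! ### Transcript expectations and change of measure -/

namespace SamplingAlgorithm

variable {S A : Type*} {K : ℕ}

section OutputProb

variable (alg : SamplingAlgorithm S A K) (M : DMDP S A) (φ : S → A → Fin K → ℝ)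

/-- The probability that the output lies in `B`, given the sampled transitions. -/
noncomputable def outputProb (B : Set (S → A)) (l : List (S × A × S)) : ℝ :=
  ((alg.output M.r φ l).toOuterMeasure B).toReal

theorem outputProb_nonneg (B : Set (S → A)) (l : List (S × A × S)) :
    0 ≤ alg.outputProb M φ B l := ENNReal.toReal_nonneg

theorem outputProb_le_one (B : Set (S → A)) (l : List (S × A × S)) :
    alg.outputProb M φ B l ≤ 1 :=
  ENNReal.toReal_le_of_le_ofReal zero_le_one (by simpa using PMF.toOuterMeasure_le_one _ B)

theorem outputProb_add_compl (B : Set (S → A)) (l : List (S × A × S)) :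
    alg.outputProb M φ B l + alg.outputProb M φ Bᶜ l = 1 := by
  have h := PMF.toOuterMeasure_add_compl (alg.output M.r φ l) B
  rw [outputProb, outputProb, ← ENNReal.toReal_add, h, ENNReal.toReal_one]
  all_goals exact ne_top_of_le_ne_top ENNReal.one_ne_top (PMF.toOuterMeasure_le_one _ _)

end OutputProb

variable [Fintype S] [Fintype A]

/-- The expectation of a real function of the first `n` sampled transitions. -/
noncomputable def expectation (alg : SamplingAlgorithm S A K) (M : DMDP S A)
    (φ : S → A → Fin K → ℝ) : ℕ → (List (S × A × S) → ℝ) → ℝ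
  | 0, F => F []
  | n + 1, F => alg.expectation M φ n fun h =>
      ∑ q : S × A, (alg.query M.r φ h q).toReal *
        ∑ s' : S, (M.P q.1 q.2 s').toReal * F ((q.1, q.2, s') :: h)

variable (alg : SamplingAlgorithm S A K) (M : DMDP S A) (φ : S → A → Fin K → ℝ)

theorem expectation_mono (n : ℕ) {F G : List (S × A × S) → ℝ} (h : ∀ l, F l ≤ G l) :
    alg.expectation M φ n F ≤ alg.expectation M φ n G := by
  induction n generalizing F G with
  | zero => exact h []
  | succ n ih =>
    exact ih fun l => Finset.sum_le_sum fun q _ => mul_le_mul_of_nonneg_left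
      (Finset.sum_le_sum fun s _ => mul_le_mul_of_nonneg_left (h _) ENNReal.toReal_nonneg)
      ENNReal.toReal_nonneg

theorem expectation_add (n : ℕ) (F G : List (S × A × S) → ℝ) :
    alg.expectation M φ n (fun l => F l + G l) =
      alg.expectation M φ n F + alg.expectation M φ n G := by
  induction n generalizing F G with
  | zero => rfl
  | succ n ih =>
    simp only [expectation, ← ih]
    congr 1
    ext l
    simp only [mul_add, Finset.sum_add_distrib]

theorem expectation_const_mul (n : ℕ) (c : ℝ) (F : List (S × A × S) → ℝ) :
    alg.expectation M φ n (fun l => c * F l) = c * alg.expectation M φ n F := by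
  induction n generalizing F with
  | zero => rfl
  | succ n ih =>
    simp only [expectation, ← ih]
    congr 1
    ext l
    simp only [Finset.mul_sum]
    refine Finset.sum_congr rfl fun q _ => Finset.sum_congr rfl fun s _ => by ring

theorem expectation_const (n : ℕ) (c : ℝ) : alg.expectation M φ n (fun _ => c) = c := by
  induction n with
  | zero => rfl
  | succ n ih => simp only [expectation, ← Finset.sum_mul, PMF.sum_toReal, one_mul, ih]

theorem expectation_sum {ι : Type*} (s : Finset ι) (n : ℕ) (F : ι → List (S × A × S) → ℝ) :
    alg.expectation M φ n (fun l => ∑ i ∈ s, F i l) = ∑ i ∈ s, alg.expectation M φ n (F i) := by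
  classical
  induction s using Finset.induction_on with
  | empty => simp [expectation_const]
  | insert i s hi ih => simp only [Finset.sum_insert hi, expectation_add, ih]

theorem expectation_length (n : ℕ) :
    alg.expectation M φ n (fun l => (l.length : ℝ)) = n := by
  induction n with
  | zero => simp [expectation]
  | succ n ih =>
    simp only [expectation, List.length_cons, ← Finset.sum_mul, PMF.sum_toReal, one_mul]
    push_cast
    rw [expectation_add, ih, expectation_const]

theorem tsum_transcript_mul (n : ℕ) {F : List (S × A × S) → ℝ} (hF : ∀ l, 0 ≤ F l) :
    ∑' l, alg.transcript M φ n l * ENNReal.ofReal (F l) =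
      ENNReal.ofReal (alg.expectation M φ n F) := by
  induction n generalizing F with
  | zero =>
    simp only [transcript, expectation]
    rw [tsum_eq_single [] fun b hb => by simp [hb]]
    simp
  | succ n ih =>
    have h0 : ∀ (l : List (S × A × S)) (q : S × A),
        0 ≤ ∑ s' : S, (M.P q.1 q.2 s').toReal * F ((q.1, q.2, s') :: l) := fun l q =>
      Finset.sum_nonneg fun s _ => mul_nonneg ENNReal.toReal_nonneg (hF _)
    rw [transcript, PMF.tsum_bind_mul, expectation,
      ← ih fun l => Finset.sum_nonneg fun q _ => mul_nonneg ENNReal.toReal_nonneg (h0 l q)]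
    refine tsum_congr fun l => ?_
    rw [PMF.tsum_bind_mul, ← PMF.tsum_mul_ofReal _ (h0 l)]
    congr 1
    refine tsum_congr fun q => ?_
    rw [PMF.tsum_map_mul, PMF.tsum_mul_ofReal _ fun s => hF _]

theorem policyLaw_toOuterMeasure (N : ℕ) (B : Set (S → A)) :
    (alg.policyLaw M φ N).toOuterMeasure B =
      ENNReal.ofReal (alg.expectation M φ N (alg.outputProb M φ B)) := by
  rw [policyLaw, PMF.toOuterMeasure_bind_apply,
    ← alg.tsum_transcript_mul M φ N (alg.outputProb_nonneg M φ B)]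
  refine tsum_congr fun l => ?_
  rw [outputProb, ENNReal.ofReal_toReal]
  exact ne_top_of_le_ne_top ENNReal.one_ne_top (PMF.toOuterMeasure_le_one _ _)

/-- An iterated Cauchy-Schwarz bound that avoids likelihood ratios: each sample with `Q` costs one
factor `δ`. Both instances show the algorithm the same rewards and features, so the query laws agree
and only Jensen is needed for them. -/
theorem sq_expectation_weight_le {M₀ M₁ : DMDP S A} (hr : M₀.r = M₁.r) (Q : S × A → Bool)
    {δ : ℝ}
    (hQ : ∀ q (f : S → ℝ), ((if Q q then δ else 1) * ∑ s, (M₀.P q.1 q.2 s).toReal * f s) ^ 2 ≤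
      ∑ s, (M₁.P q.1 q.2 s).toReal * f s ^ 2)
    (n : ℕ) (g : List (S × A × S) → ℝ) :
    alg.expectation M₀ φ n (fun l => δ ^ l.countP (fun e => Q (e.1, e.2.1)) * g l) ^ 2 ≤
      alg.expectation M₁ φ n (fun l => g l ^ 2) := by
  induction n generalizing g with
  | zero => simp [expectation]
  | succ n ih =>
    have key := ih fun l => ∑ q : S × A, (alg.query M₀.r φ l q).toReal *
      ((if Q q then δ else 1) * ∑ s', (M₀.P q.1 q.2 s').toReal * g ((q.1, q.2, s') :: l))
    -- The induction hypothesis is applied to `g` with the newest sample averaged out, its factor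
    -- `δ` included.
    refine le_trans (le_of_eq ?_) (key.trans (expectation_mono _ _ _ _ fun l => ?_))
    · rw [expectation]
      congr 2
      ext l
      simp only [Finset.mul_sum]
      refine Finset.sum_congr rfl fun q _ => Finset.sum_congr rfl fun s _ => ?_
      rw [List.countP_cons]
      split_ifs <;> ring
    · refine ((even_two.convexOn_pow (𝕜 := ℝ)).map_sum_le
        (fun q _ => ENNReal.toReal_nonneg) (PMF.sum_toReal (alg.query M₀.r φ l))
        (fun q _ => Set.mem_univ _)).trans ?_
      rw [hr]
      exact Finset.sum_le_sum fun q _ => mul_le_mul_of_nonneg_left (hQ q _) ENNReal.toReal_nonneg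

/-- If, for each `k`, the instances `M₀` and `M₁ k` differ by a divergence at most `d` on the
pairs labelled `k` and not at all on the other pairs, then for some `k` an event that is likely
under `M₀` is not unlikely under `M₁ k`. -/
theorem exists_change_of_measure {ι : Type*} [Fintype ι] [Nonempty ι] [DecidableEq ι]
    (κ : S × A → ι) {M₀ : DMDP S A} {M₁ : ι → DMDP S A}
    (hr : ∀ k, M₀.r = (M₁ k).r) {d : ℝ} (hd0 : 0 ≤ d) (hd1 : d ≤ 1)
    (hdiv : ∀ k q (f : S → ℝ),
      ((if κ q = k then 1 - d else 1) * ∑ s, (M₀.P q.1 q.2 s).toReal * f s) ^ 2 ≤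
        ∑ s, ((M₁ k).P q.1 q.2 s).toReal * f s ^ 2) (N : ℕ) :
    ∃ k, ∀ B : Set (S → A), d * (N / Fintype.card ι) ≤
        alg.expectation M₀ φ N (alg.outputProb M₀ φ B) →
      (alg.expectation M₀ φ N (alg.outputProb M₀ φ B) - d * (N / Fintype.card ι)) ^ 2 ≤
        alg.expectation (M₁ k) φ N (alg.outputProb (M₁ k) φ B) := by
  let C : ι → List (S × A × S) → ℕ := fun k l => l.countP fun e => decide (κ (e.1, e.2.1) = k)
  have hC : ∀ l, ∑ k, (C k l : ℝ) = l.length := by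
    intro l
    induction l with
    | nil => simp [C]
    | cons e l ih =>
      simp only [C, List.countP_cons] at ih ⊢
      push_cast
      rw [Finset.sum_add_distrib, ih]
      simp
  have hsum : ∑ k, alg.expectation M₀ φ N (fun l => (C k l : ℝ)) ≤
      ∑ _k : ι, (N / Fintype.card ι : ℝ) := by
    rw [← expectation_sum]
    simp only [hC, expectation_length, Finset.sum_const, Finset.card_univ, nsmul_eq_mul]
    rw [mul_div_cancel₀]
    exact Nat.cast_ne_zero.2 Fintype.card_ne_zero
  obtain ⟨k, -, hk⟩ := Finset.exists_le_of_sum_le Finset.univ_nonempty hsum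
  refine ⟨k, fun B hB => ?_⟩
  have hg : alg.outputProb (M₁ k) φ B = alg.outputProb M₀ φ B := by
    ext l; rw [outputProb, outputProb, hr k]
  set g := alg.outputProb M₀ φ B with hgdef
  have h0 : ∀ l, 0 ≤ g l := alg.outputProb_nonneg M₀ φ B
  have h1 : ∀ l, g l ≤ 1 := alg.outputProb_le_one M₀ φ B
  have step := alg.sq_expectation_weight_le φ (hr k) (fun q => decide (κ q = k)) (δ := 1 - d)
    (fun q f => by simpa using hdiv k q f) N g
  have low : alg.expectation M₀ φ N g - d * (N / Fintype.card ι) ≤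
      alg.expectation M₀ φ N (fun l => (1 - d) ^ C k l * g l) := by
    have hle : alg.expectation M₀ φ N g ≤ alg.expectation M₀ φ N
        (fun l => (1 - d) ^ C k l * g l + d * (C k l : ℝ)) := by
      refine expectation_mono _ _ _ _ fun l => ?_
      -- Bernoulli's inequality makes the loss linear in the count, so only the mean of `C k`
      -- matters.
      have hb : 1 - (C k l : ℝ) * d ≤ (1 - d) ^ C k l := by
        have := one_add_mul_le_pow (a := -d) (by linarith) (C k l)
        rw [← sub_eq_add_neg] at this
        linarith
      have hb1 : (1 - d) ^ C k l ≤ 1 := pow_le_one₀ (by linarith) (by linarith)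
      nlinarith [h0 l, h1 l]
    rw [expectation_add, expectation_const_mul] at hle
    have := mul_le_mul_of_nonneg_left hk hd0
    linarith
  rw [hg]
  refine (pow_le_pow_left₀ (by linarith) low 2).trans (step.trans ?_)
  exact expectation_mono _ _ _ _ fun l => by nlinarith [h0 l, h1 l]

end SamplingAlgorithm

/-! ### Choice of the hard state-action pairs -/

theorem Fintype.exists_pairs_of_le_card_mul_card {S A : Type*} [Fintype S] [Fintype A]
    (hS : 2 ≤ Fintype.card S) (hA : 2 ≤ Fintype.card A) {K : ℕ} (hK : 2 ≤ K)
    (hKSA : K ≤ Fintype.card S * Fintype.card A) :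
    ∃ (m : ℕ) (y : S) (a₀ : A) (x : Fin m → S) (a : Fin m → A) (κ : S → A → Fin m),
      0 < m ∧ m + 1 ≤ K ∧ K ≤ 4 * m ∧ (∀ i, x i ≠ y) ∧ (∀ i, a i ≠ a₀) ∧
      (∀ i, κ (x i) (a i) = i) ∧ ∀ i, x (κ (x i) a₀) = x i := by
  classical
  obtain ⟨y⟩ : Nonempty S := Fintype.card_pos_iff.1 (by omega)
  obtain ⟨a₀⟩ : Nonempty A := Fintype.card_pos_iff.1 (by omega)
  -- One feature is reserved for jumping to `y`; discarding `y` and `a₀` keeps at least a quarter of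
  -- all pairs.
  set m := min (K - 1) ((Fintype.card S - 1) * (Fintype.card A - 1)) with hm
  have hcard : Fintype.card ({s : S // s ≠ y} × {a : A // a ≠ a₀}) =
      (Fintype.card S - 1) * (Fintype.card A - 1) := by
    rw [Fintype.card_prod]
    congr 1 <;> simp [Fintype.card_subtype_compl]
  have hprod : Fintype.card S * Fintype.card A ≤
      4 * ((Fintype.card S - 1) * (Fintype.card A - 1)) := by
    obtain ⟨s, hs⟩ := Nat.exists_eq_add_of_le hS
    obtain ⟨t, ht⟩ := Nat.exists_eq_add_of_le hA
    have e1 : Fintype.card S - 1 = s + 1 := by omega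
    have e2 : Fintype.card A - 1 = t + 1 := by omega
    rw [e1, e2, hs, ht]
    nlinarith
  have hm0 : 0 < m := by omega
  have hmK : m + 1 ≤ K := by omega
  have hKm : K ≤ 4 * m := by omega
  obtain ⟨e⟩ : Nonempty (Fin m ↪ {s : S // s ≠ y} × {a : A // a ≠ a₀}) :=
    Function.Embedding.nonempty_of_card_le (by rw [hcard, Fintype.card_fin]; omega)
  refine ⟨m, y, a₀, fun i => (e i).1, fun i => (e i).2,
    -- A non-hard action at a hard state borrows the label of some pair there; the default label `0`
    -- serves all remaining states.
    fun s b => if h : ∃ i, ((e i).1 : S) = s ∧ ((e i).2 : A) = b then h.choose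
      else if h : ∃ i, ((e i).1 : S) = s then h.choose else ⟨0, hm0⟩,
    hm0, hmK, hKm, fun i => (e i).1.2, fun i => (e i).2.2, fun i => ?_, fun i => ?_⟩
  · have h : ∃ j, ((e j).1 : S) = (e i).1 ∧ ((e j).2 : A) = (e i).2 := ⟨i, rfl, rfl⟩
    beta_reduce
    rw [dif_pos h]
    have hc := h.choose_spec
    exact e.injective (Prod.ext (Subtype.ext hc.1) (Subtype.ext hc.2))
  · have h' : ∃ j, ((e j).1 : S) = (e i).1 := ⟨i, rfl⟩
    beta_reduce
    rw [dif_neg, dif_pos h']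
    · exact h'.choose_spec
    · rintro ⟨j, -, hj⟩
      exact (e j).2.2 hj

/-! ### Values of self-loop processes and the one-step divergence -/

namespace DMDP

variable {S A : Type*} [Fintype S]

theorem value_le_optValue [Finite A] (M : DMDP S A) (π : S → A) (s : S) :
    M.value π s ≤ M.optValue s :=
  le_ciSup (f := fun π => M.value π s) (Set.finite_range _).bddAbove π

theorem value_sub_value_le_subopt [Finite A] (M : DMDP S A) (π π' : S → A) (s : S) :
    M.value π' s - M.value π s ≤ M.subopt π :=
  (sub_le_sub_right (M.value_le_optValue π' s) _).trans
    (le_ciSup (f := fun s => M.optValue s - M.value π s) (Set.finite_range _).bddAbove s)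

open Classical in
/-- The law that stays at `s` with probability `p` and jumps to `y` otherwise. -/
noncomputable def stayLaw (y : S) (p : ℝ) (hp : p ∈ Set.Icc (0 : ℝ) 1) (s : S) : PMF S :=
  PMF.ofFintype
    (fun s' => ENNReal.ofReal (p * (if s' = s then 1 else 0) + (1 - p) * if s' = y then 1 else 0))
    (by
      have := hp.1
      have := hp.2
      rw [← ENNReal.ofReal_sum_of_nonneg fun s' _ => by split_ifs <;> simp [*]]
      simp [Finset.sum_add_distrib])

open Classical in
theorem toReal_stayLaw (y : S) (p : ℝ) (hp : p ∈ Set.Icc (0 : ℝ) 1) (s s' : S) :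
    (stayLaw y p hp s s').toReal =
      p * (if s' = s then 1 else 0) + (1 - p) * if s' = y then 1 else 0 := by
  have := hp.1
  have := hp.2
  rw [stayLaw, PMF.ofFintype_apply, ENNReal.toReal_ofReal]
  split_ifs <;> simp [*]

theorem sum_toReal_stayLaw_mul (y : S) (p : ℝ) (hp : p ∈ Set.Icc (0 : ℝ) 1) (s : S) (f : S → ℝ) :
    ∑ s', (stayLaw y p hp s s').toReal * f s' = p * f s + (1 - p) * f y := by
  classical
  simp only [toReal_stayLaw, add_mul, Finset.sum_add_distrib, mul_assoc, ← Finset.mul_sum,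
    ite_mul, one_mul, zero_mul]
  simp only [Finset.sum_ite_eq', Finset.mem_univ, if_true]

variable {M : DMDP S A} {y : S} {p : S → A → ℝ} {hp : ∀ s a, p s a ∈ Set.Icc (0 : ℝ) 1}

open Classical in
theorem toReal_stateLaw_of_stay (hP : ∀ s a, M.P s a = stayLaw y (p s a) (hp s a) s)
    (π : S → A) (s : S) (t : ℕ) {z : S} (hz : z ≠ y) :
    (M.stateLaw π s t z).toReal = if z = s then p s (π s) ^ t else 0 := by
  induction t with
  | zero =>
    simp only [stateLaw, PMF.pure_apply, pow_zero]
    split_ifs <;> simp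
  | succ t ih =>
    rw [stateLaw, PMF.toReal_bind_apply]
    simp only [hP, toReal_stayLaw, if_neg hz, mul_zero, add_zero]
    rw [Finset.sum_eq_single z (fun b _ hb => by simp [hb.symm]) (by simp), ih,
      if_pos (rfl : z = z), mul_one]
    split_ifs with h
    · subst h; rw [pow_succ]
    · rw [zero_mul]

theorem value_of_stay (hP : ∀ s a, M.P s a = stayLaw y (p s a) (hp s a) s)
    (hr : ∀ a, M.r y a = 0) (π : S → A) {s : S} (hs : s ≠ y) :
    M.value π s = M.r s (π s) / (1 - M.γ * p s (π s)) := by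
  classical
  have hsum : ∀ t, ∑ x : S, (M.stateLaw π s t x).toReal * M.r x (π x) =
      p s (π s) ^ t * M.r s (π s) := by
    intro t
    rw [Finset.sum_eq_single s]
    · rw [toReal_stateLaw_of_stay hP π s t hs, if_pos rfl]
    · intro x _ hx
      by_cases hxy : x = y
      · rw [hxy, hr, mul_zero]
      · rw [toReal_stateLaw_of_stay hP π s t hxy, if_neg hx, zero_mul]
    · simp
  have h0 : 0 ≤ M.γ * p s (π s) := mul_nonneg M.γ_pos.le (hp s _).1
  have h1 : M.γ * p s (π s) < 1 :=
    (mul_le_of_le_one_right M.γ_pos.le (hp s _).2).trans_lt M.γ_lt_one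
  simp only [value, hsum, ← mul_assoc, ← mul_pow]
  rw [tsum_mul_right, tsum_geometric_of_lt_one h0 h1, div_eq_inv_mul]

/-- Cauchy-Schwarz gives `1 + χ²` as the constant, where `χ² = (b - a)² / (b (1 - b)) ≤ d` if `b >
0`, and `(1 - d)² (1 + d) ≤ 1` absorbs it. -/
theorem sq_stay_average_le {a b d u v : ℝ} (ha : 0 ≤ a) (hab : a ≤ b) (hb : b < 1)
    (hd0 : 0 ≤ d) (hd1 : d ≤ 1) (hdiv : (b - a) ^ 2 ≤ d * (b * (1 - b))) :
    ((1 - d) * (a * u + (1 - a) * v)) ^ 2 ≤ b * u ^ 2 + (1 - b) * v ^ 2 := by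
  have hb0 : 0 ≤ b := ha.trans hab
  have hR : 0 ≤ b * u ^ 2 + (1 - b) * v ^ 2 := by
    have : 0 ≤ 1 - b := by linarith
    positivity
  rcases hb0.eq_or_lt with rfl | hb0
  · obtain rfl : a = 0 := le_antisymm hab ha
    have : (1 - d) ^ 2 ≤ 1 := by nlinarith
    nlinarith [mul_nonneg (sub_nonneg.2 this) (sq_nonneg v)]
  · have hB : 0 < b * (1 - b) := mul_pos hb0 (by linarith)
    have h1 : b * (1 - b) * (a * u + (1 - a) * v) ^ 2 ≤
        (b * (1 - b) + (b - a) ^ 2) * (b * u ^ 2 + (1 - b) * v ^ 2) := by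
      linarith [sq_nonneg (a * (1 - b) * v - (1 - a) * b * u),
        show (b * (1 - b) + (b - a) ^ 2) * (b * u ^ 2 + (1 - b) * v ^ 2) -
          b * (1 - b) * (a * u + (1 - a) * v) ^ 2 =
          (a * (1 - b) * v - (1 - a) * b * u) ^ 2 by ring]
    have h2 : b * (1 - b) * (a * u + (1 - a) * v) ^ 2 ≤
        b * (1 - b) * ((1 + d) * (b * u ^ 2 + (1 - b) * v ^ 2)) := by
      refine h1.trans ?_
      nlinarith [mul_le_mul_of_nonneg_right hdiv hR]
    have h3 := le_of_mul_le_mul_left h2 hB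
    have h4 : (1 - d) ^ 2 * (1 + d) ≤ 1 := by nlinarith [sq_nonneg d, mul_nonneg hd0 hd0]
    rw [mul_pow]
    calc (1 - d) ^ 2 * (a * u + (1 - a) * v) ^ 2
        ≤ (1 - d) ^ 2 * ((1 + d) * (b * u ^ 2 + (1 - b) * v ^ 2)) :=
          mul_le_mul_of_nonneg_left h3 (sq_nonneg _)
      _ = (1 - d) ^ 2 * (1 + d) * (b * u ^ 2 + (1 - b) * v ^ 2) := by ring
      _ ≤ _ := mul_le_of_le_one_left hR h4

end DMDP

/-! ### The family of instances and its features -/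

namespace DMDP

variable {S A : Type*} [Fintype S]

/-- The instance that from `s` under `a` stays at `s` with probability `μ s a * θ (κ s a)` and
otherwise jumps to `y`. -/
noncomputable def selfLoop {ι : Type*} (y : S) (κ : S → A → ι) (μ : S → A → ℝ)
    (hμ : ∀ s a, μ s a ∈ Set.Icc (0 : ℝ) 1) (r : S → A → ℝ) (hr : ∀ s a, r s a ∈ Set.Icc (0 : ℝ) 1)
    (γ : ℝ) (hγ : γ ∈ Set.Ioo (0 : ℝ) 1) (θ : ι → ℝ) (hθ : ∀ i, θ i ∈ Set.Icc (0 : ℝ) 1) :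
    DMDP S A where
  P s a := stayLaw y (μ s a * θ (κ s a)) (unitInterval.mul_mem (hμ s a) (hθ _)) s
  r := r
  γ := γ
  r_nonneg s a := (hr s a).1
  r_le_one s a := (hr s a).2
  γ_pos := hγ.1
  γ_lt_one := hγ.2

/-- Each transition law mixes the law of its label with the jump to `y`, with weights `μ` and `1 -
μ`. The unknown `θ` enters only `ψ`, so knowing the features reveals nothing about it. -/
theorem admitsFeatures_selfLoop {m K : ℕ} (hmK : m + 1 ≤ K) {y : S} {κ : S → A → Fin m}
    {μ : S → A → ℝ} {hμ : ∀ s a, μ s a ∈ Set.Icc (0 : ℝ) 1} {r : S → A → ℝ}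
    {hr : ∀ s a, r s a ∈ Set.Icc (0 : ℝ) 1} {γ : ℝ} {hγ : γ ∈ Set.Ioo (0 : ℝ) 1} {θ : Fin m → ℝ}
    {hθ : ∀ i, θ i ∈ Set.Icc (0 : ℝ) 1} (x : Fin m → S) (hx : ∀ s a, μ s a ≠ 0 → s = x (κ s a)) :
    (selfLoop y κ μ hμ r hr γ hγ θ hθ).AdmitsFeatures fun s a (j : Fin K) =>
      μ s a * (if (j : ℕ) = κ s a + 1 then 1 else 0) +
        (1 - μ s a) * if (j : ℕ) = 0 then 1 else 0 := by
  classical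
  let e : Fin m → Fin K := fun i => ⟨i + 1, by omega⟩
  let z : Fin K := ⟨0, by omega⟩
  refine ⟨fun j s' => if h : ∃ i, e i = j then
    θ h.choose * (if s' = x h.choose then 1 else 0) + (1 - θ h.choose) * (if s' = y then 1 else 0)
    else if s' = y then 1 else 0, fun s a s' => ?_⟩
  have he : Function.Injective e := fun i j h => by
    have := congrArg Fin.val h
    simp only [e] at this
    exact Fin.ext (by omega)
  have hz : ¬ ∃ i, e i = z := by
    rintro ⟨i, hi⟩
    simpa [e, z] using congrArg Fin.val hi
  have h1 : ∀ j : Fin K, ((j : ℕ) = κ s a + 1) = (j = e (κ s a)) := fun j => by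
    simp [e, Fin.ext_iff]
  have h2 : ∀ j : Fin K, ((j : ℕ) = 0) = (j = z) := fun j => by simp [z, Fin.ext_iff]
  simp only [h1, h2, add_mul, Finset.sum_add_distrib, mul_assoc, ← Finset.mul_sum, ite_mul,
    one_mul, zero_mul, Finset.sum_ite_eq', Finset.mem_univ, if_true]
  have hex : ∃ i, e i = e (κ s a) := ⟨_, rfl⟩
  rw [dif_pos hex, dif_neg hz, he hex.choose_spec]
  simp only [selfLoop, toReal_stayLaw]
  by_cases h : μ s a = 0
  · simp [h]
  · rw [← hx s a h]
    ring

/-- Scaling both stay probabilities by `μ ≤ 1` does not spoil the divergence bound, so `a₀` is no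
more informative than the pair it borrows from. -/
theorem sq_weighted_sum_selfLoop_le {ι : Type*} {y : S} {κ : S → A → ι}
    {μ : S → A → ℝ} {hμ : ∀ s a, μ s a ∈ Set.Icc (0 : ℝ) 1} {r : S → A → ℝ}
    {hr : ∀ s a, r s a ∈ Set.Icc (0 : ℝ) 1} {γ : ℝ} {hγ : γ ∈ Set.Ioo (0 : ℝ) 1} {θ₀ θ₁ : ι → ℝ}
    {hθ₀ : ∀ i, θ₀ i ∈ Set.Icc (0 : ℝ) 1} {hθ₁ : ∀ i, θ₁ i ∈ Set.Icc (0 : ℝ) 1}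
    {d : ℝ} (hd0 : 0 ≤ d) (hd1 : d ≤ 1) (s : S) (a : A) (f : S → ℝ)
    (hle : θ₀ (κ s a) ≤ θ₁ (κ s a)) (hlt : θ₁ (κ s a) < 1)
    (hdiv : (θ₁ (κ s a) - θ₀ (κ s a)) ^ 2 ≤ d * (θ₁ (κ s a) * (1 - θ₁ (κ s a)))) :
    ((1 - d) * ∑ s', ((selfLoop y κ μ hμ r hr γ hγ θ₀ hθ₀).P s a s').toReal * f s') ^ 2 ≤
      ∑ s', ((selfLoop y κ μ hμ r hr γ hγ θ₁ hθ₁).P s a s').toReal * f s' ^ 2 := by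
  have h0 := hμ s a
  have h1 := (hθ₀ (κ s a)).1
  have h2 := (hθ₁ (κ s a)).1
  set b := θ₁ (κ s a)
  simp only [selfLoop, sum_toReal_stayLaw_mul]
  refine sq_stay_average_le (mul_nonneg h0.1 h1) (mul_le_mul_of_nonneg_left hle h0.1) ?_ hd0 hd1 ?_
  · exact (mul_le_of_le_one_left h2 h0.2).trans_lt hlt
  · rw [← mul_sub, mul_pow]
    have hb : μ s a * b ≤ b := mul_le_of_le_one_left h2 h0.2
    calc μ s a ^ 2 * (b - θ₀ (κ s a)) ^ 2 ≤ μ s a * (d * (b * (1 - b))) := by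
          refine mul_le_mul ?_ hdiv (sq_nonneg _) h0.1
          nlinarith [h0.1, h0.2]
      _ = d * (μ s a * b * (1 - b)) := by ring
      _ ≤ d * (μ s a * b * (1 - μ s a * b)) :=
          mul_le_mul_of_nonneg_left
            (mul_le_mul_of_nonneg_left (by linarith) (mul_nonneg h0.1 h2)) hd0

end DMDP

/-! ### The value gap between the two actions -/

/-- At `p = γ` both values equal `1 / (1 - γ³)`, hence the factor `p - γ`. -/
theorem value_gap_identity {γ p : ℝ} (hγ : γ ∈ Set.Ioo (0 : ℝ) 1) (hp : p ∈ Set.Icc (0 : ℝ) 1) :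
    (1 + γ) / (1 + γ + γ ^ 2) / (1 - γ * p) - 1 / (1 - γ * (γ * p)) =
      γ * (p - γ) / ((1 + γ + γ ^ 2) * ((1 - γ * p) * (1 - γ * (γ * p)))) := by
  obtain ⟨h0, h1⟩ := hγ
  have hX : 1 - γ * p ≠ 0 := by nlinarith [hp.1, hp.2]
  have hY : 1 - γ * (γ * p) ≠ 0 := by
    have : γ * (γ * p) ≤ γ * 1 := mul_le_mul_of_nonneg_left (by nlinarith [hp.1, hp.2]) h0.le
    linarith
  have hs : 1 + γ + γ ^ 2 ≠ 0 := by positivity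
  rw [div_div, div_sub_div _ _ (mul_ne_zero hs hX) hY,
    div_eq_div_iff (mul_ne_zero (mul_ne_zero hs hX) hY) (mul_ne_zero hs (mul_ne_zero hX hY))]
  ring

theorem value_gap_denominator {γ p : ℝ} (hγ : γ ∈ Set.Ioo (0 : ℝ) 1) (hp : p ∈ Set.Icc (0 : ℝ) 1)
    (hpγ : γ - (1 - γ) / 2 ≤ p) :
    0 < (1 + γ + γ ^ 2) * ((1 - γ * p) * (1 - γ * (γ * p))) ∧
      (1 + γ + γ ^ 2) * ((1 - γ * p) * (1 - γ * (γ * p))) < 40 * (1 - γ) ^ 2 := by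
  obtain ⟨h0, h1⟩ := hγ
  have hX : 0 < 1 - γ * p := by nlinarith [hp.1, hp.2]
  have hY : 0 < 1 - γ * (γ * p) := by
    have : γ * (γ * p) ≤ γ * 1 := mul_le_mul_of_nonneg_left (by nlinarith [hp.1, hp.2]) h0.le
    linarith
  have hX' : 1 - γ * p ≤ 5 / 2 * (1 - γ) := by
    nlinarith [mul_le_mul_of_nonneg_left hpγ h0.le]
  have hY' : 1 - γ * (γ * p) ≤ 7 / 2 * (1 - γ) := by
    have := mul_le_mul_of_nonneg_left hX' h0.le
    nlinarith
  have hs : 1 + γ + γ ^ 2 ≤ 3 := by nlinarith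
  refine ⟨by positivity, ?_⟩
  have hβ : 0 < 1 - γ := by linarith
  calc (1 + γ + γ ^ 2) * ((1 - γ * p) * (1 - γ * (γ * p)))
      ≤ 3 * ((5 / 2 * (1 - γ)) * (7 / 2 * (1 - γ))) := by gcongr
    _ < _ := by nlinarith [pow_pos hβ 2]

theorem value_gap_high {γ ε : ℝ} (hγ : γ ∈ Set.Ioo (0 : ℝ) 1) (hε : 0 < ε)
    (hp : γ + 40 * ε * (1 - γ) ^ 2 / γ ∈ Set.Icc (0 : ℝ) 1) :
    1 / (1 - γ * (γ * (γ + 40 * ε * (1 - γ) ^ 2 / γ))) + ε <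
      (1 + γ) / (1 + γ + γ ^ 2) / (1 - γ * (γ + 40 * ε * (1 - γ) ^ 2 / γ)) := by
  have hD : 0 ≤ 40 * ε * (1 - γ) ^ 2 / γ := by have := hγ.1; positivity
  obtain ⟨h0, h1⟩ := value_gap_denominator hγ hp (by linarith [hγ.2])
  rw [← lt_sub_iff_add_lt', value_gap_identity hγ hp, lt_div_iff₀ h0, add_sub_cancel_left,
    mul_div_cancel₀ _ hγ.1.ne']
  nlinarith

theorem value_gap_low {γ ε : ℝ} (hγ : γ ∈ Set.Ioo (0 : ℝ) 1) (hε : 0 < ε)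
    (hp : γ - 40 * ε * (1 - γ) ^ 2 / γ ∈ Set.Icc (0 : ℝ) 1)
    (hD : 40 * ε * (1 - γ) ^ 2 / γ ≤ (1 - γ) / 2) :
    (1 + γ) / (1 + γ + γ ^ 2) / (1 - γ * (γ - 40 * ε * (1 - γ) ^ 2 / γ)) + ε <
      1 / (1 - γ * (γ * (γ - 40 * ε * (1 - γ) ^ 2 / γ))) := by
  obtain ⟨h0, h1⟩ := value_gap_denominator hγ hp (by linarith [hγ.2])
  have hid := value_gap_identity hγ hp
  rw [sub_sub_cancel_left, mul_neg, mul_div_cancel₀ _ hγ.1.ne', neg_div] at hid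
  have : ε < 40 * ε * (1 - γ) ^ 2 / ((1 + γ + γ ^ 2) *
      ((1 - γ * (γ - 40 * ε * (1 - γ) ^ 2 / γ)) *
        (1 - γ * (γ * (γ - 40 * ε * (1 - γ) ^ 2 / γ))))) := by
    rw [lt_div_iff₀ h0]
    nlinarith
  linarith

/-! ### The lower bound -/

open DMDP in
theorem SamplingAlgorithm.exists_instance_subopt_gt {S A : Type*} [Fintype S] [Fintype A]
    (hS : 2 ≤ Fintype.card S) (hA : 2 ≤ Fintype.card A) {K : ℕ} (hK : 2 ≤ K)
    (hKSA : K ≤ Fintype.card S * Fintype.card A) {γ ε : ℝ} (hγ : γ ∈ Set.Ioo (0 : ℝ) 1)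
    (hε : 0 < ε) (hD : 40 * ε * (1 - γ) ^ 2 / γ ≤ (1 - γ) / 2)
    (hDγ : 40 * ε * (1 - γ) ^ 2 / γ ≤ γ)
    (hd1 : 12800 * ε ^ 2 * (1 - γ) ^ 3 / γ ^ 3 ≤ 1) {N : ℕ}
    (hN : 12800 * ε ^ 2 * (1 - γ) ^ 3 / γ ^ 3 * (4 * N / K) ≤ 2 / 25)
    (alg : SamplingAlgorithm S A K) :
    ∃ φ : S → A → Fin K → ℝ, ∃ M ∈ DMDP.featureClass γ φ,
      1 / 3 ≤ (alg.policyLaw M φ N).toOuterMeasure {π | ε < M.subopt π} := by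
  classical
  obtain ⟨m, y, a₀, x, a, κ, hm, hmK, hKm, hxy, ha, hκ, hκ₀⟩ :=
    Fintype.exists_pairs_of_le_card_mul_card hS hA hK hKSA
  have hγ0 := hγ.1
  have hγ1 := hγ.2
  have hβ : 0 < 1 - γ := by linarith
  have low := value_gap_low hγ hε
  have high := value_gap_high hγ hε
  have hD0 : 0 < 40 * ε * (1 - γ) ^ 2 / γ := by positivity
  -- The parameters differ by `2 * D`, and `γ * ((1 - γ) / 2)` bounds `b (1 - b)` from below at `b =
  -- γ + D`; this fixes `d`.
  have hDd : (2 * (40 * ε * (1 - γ) ^ 2 / γ)) ^ 2 =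
      12800 * ε ^ 2 * (1 - γ) ^ 3 / γ ^ 3 * (γ * ((1 - γ) / 2)) := by
    field_simp
    ring
  have hd0 : 0 ≤ 12800 * ε ^ 2 * (1 - γ) ^ 3 / γ ^ 3 := by positivity
  set D := 40 * ε * (1 - γ) ^ 2 / γ
  set d := 12800 * ε ^ 2 * (1 - γ) ^ 3 / γ ^ 3
  have hlo : γ - D ∈ Set.Icc (0 : ℝ) 1 := ⟨by linarith, by linarith⟩
  have hhi : γ + D ∈ Set.Icc (0 : ℝ) 1 := ⟨by linarith, by linarith⟩
  specialize low hlo hD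
  specialize high hhi
  set ρ := (1 + γ) / (1 + γ + γ ^ 2)
  have hρ : ρ ∈ Set.Icc (0 : ℝ) 1 :=
    ⟨by positivity, div_le_one_of_le₀ (by nlinarith) (by positivity)⟩
  -- Letting `a₀` stay with `γ` times a parameter already in use, rather than with a fixed
  -- probability, costs no extra feature.
  let μ : S → A → ℝ := fun s b =>
    if s = x (κ s b) then if b = a (κ s b) then 1 else if b = a₀ then γ else 0 else 0
  let r : S → A → ℝ := fun s b =>
    if s = x (κ s b) then if b = a (κ s b) then ρ else if b = a₀ then 1 else 0 else 0
  have hμ : ∀ s b, μ s b ∈ Set.Icc (0 : ℝ) 1 := fun s b => by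
    simp only [μ]
    split_ifs <;> simp [hγ0.le, hγ1.le]
  have hr : ∀ s b, r s b ∈ Set.Icc (0 : ℝ) 1 := fun s b => by
    simp only [r]
    split_ifs <;> simp [hρ.1, hρ.2]
  have hry : ∀ b, r y b = 0 := fun b => if_neg (hxy _).symm
  let M : (θ : Fin m → ℝ) → (∀ i, θ i ∈ Set.Icc (0 : ℝ) 1) → DMDP S A :=
    fun θ hθ => selfLoop y κ μ hμ r hr γ hγ θ hθ
  have hval : ∀ θ hθ π s, s ≠ y →
      (M θ hθ).value π s = r s (π s) / (1 - γ * (μ s (π s) * θ (κ s (π s)))) :=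
    fun θ hθ π s hs => value_of_stay (M := M θ hθ)
      (hp := fun s b => unitInterval.mul_mem (hμ s b) (hθ _)) (fun _ _ => rfl) hry π hs
  let θ₀ : Fin m → ℝ := fun _ => γ - D
  let θ₁ : Fin m → Fin m → ℝ := fun k i => if i = k then γ + D else γ - D
  have hθ₀ : ∀ i, θ₀ i ∈ Set.Icc (0 : ℝ) 1 := fun _ => hlo
  have hθ₁ : ∀ k i, θ₁ k i ∈ Set.Icc (0 : ℝ) 1 := fun k i => by
    simp only [θ₁]; split_ifs <;> assumption
  have hrx : ∀ k, r (x k) (a k) = ρ ∧ μ (x k) (a k) = 1 := fun k => by simp [r, μ, hκ]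
  have hrx₀ : ∀ k, r (x k) a₀ = 1 ∧ μ (x k) a₀ = γ := fun k => by
    simp [r, μ, hκ₀, (ha _).symm]
  have hbad₀ : ∀ k (π : S → A), π (x k) = a k → ε < (M θ₀ hθ₀).subopt π := by
    intro k π hπ
    refine lt_of_lt_of_le ?_
      ((M θ₀ hθ₀).value_sub_value_le_subopt π (Function.update π (x k) a₀) (x k))
    rw [hval _ _ _ _ (hxy k), hval _ _ _ _ (hxy k), Function.update_self, hπ, (hrx k).1,
      (hrx k).2, (hrx₀ k).1, (hrx₀ k).2, one_mul]
    linarith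
  have hbad₁ : ∀ k (π : S → A), π (x k) ≠ a k → ε < (M (θ₁ k) (hθ₁ k)).subopt π := by
    intro k π hπ
    refine lt_of_lt_of_le ?_ ((M (θ₁ k) (hθ₁ k)).value_sub_value_le_subopt π
      (Function.update π (x k) (a k)) (x k))
    rw [hval _ _ _ _ (hxy k), hval _ _ _ _ (hxy k), Function.update_self, (hrx k).1,
      (hrx k).2, one_mul]
    have hself : θ₁ k (κ (x k) (a k)) = γ + D := by simp [θ₁, hκ]
    rw [hself]
    have hpos : 0 < 1 - γ * (γ * (γ + D)) := by
      have h1 : γ * (γ + D) ≤ 1 := mul_le_one₀ hγ1.le hhi.1 hhi.2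
      nlinarith
    -- The label of `(x k, a₀)` may or may not be `k`; monotonicity covers both cases.
    have hmono : ∀ p ≤ γ + D, 1 / (1 - γ * (γ * p)) ≤ 1 / (1 - γ * (γ * (γ + D))) := by
      intro p hp
      have := mul_le_mul_of_nonneg_left (mul_le_mul_of_nonneg_left hp hγ0.le) hγ0.le
      exact one_div_le_one_div_of_le hpos (by linarith)
    suffices h : r (x k) (π (x k)) /
        (1 - γ * (μ (x k) (π (x k)) * θ₁ k (κ (x k) (π (x k))))) ≤
          1 / (1 - γ * (γ * (γ + D))) by linarith
    by_cases h1 : x k = x (κ (x k) (π (x k)))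
    · by_cases h2 : π (x k) = a (κ (x k) (π (x k)))
      · have hne : κ (x k) (π (x k)) ≠ k := fun h => hπ (by rw [h2, h])
        simp only [r, μ, θ₁, if_pos h1, if_pos h2, if_neg hne, one_mul]
        linarith [hmono (γ - D) (by linarith)]
      · by_cases h3 : π (x k) = a₀
        · rw [h3, (hrx₀ k).1, (hrx₀ k).2]
          refine hmono _ ?_
          simp only [θ₁]
          split_ifs <;> linarith
        · simp only [r, if_pos h1, if_neg h2, if_neg h3, zero_div]
          positivity
    · simp only [r, if_neg h1, zero_div]
      positivity
  let φ : S → A → Fin K → ℝ := fun s b j =>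
    μ s b * (if (j : ℕ) = κ s b + 1 then 1 else 0) + (1 - μ s b) * if (j : ℕ) = 0 then 1 else 0
  have hM : ∀ θ hθ, M θ hθ ∈ featureClass γ φ := fun θ hθ =>
    ⟨rfl, admitsFeatures_selfLoop hmK x fun s b h => by
      by_contra hs
      exact h (if_neg hs)⟩
  by_contra! hcon
  replace hcon : ∀ θ hθ (B : Set (S → A)), (∀ π ∈ B, ε < (M θ hθ).subopt π) →
      alg.expectation (M θ hθ) φ N (alg.outputProb (M θ hθ) φ B) < 1 / 3 := by
    intro θ hθ B hB
    have h := (MeasureTheory.measure_mono (μ := (alg.policyLaw (M θ hθ) φ N).toOuterMeasure)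
      (show B ⊆ {π | ε < (M θ hθ).subopt π} from hB)).trans_lt
      (hcon φ _ (hM θ hθ))
    have h3 : (1 / 3 : ENNReal) = ENNReal.ofReal (1 / 3) := by
      rw [ENNReal.ofReal_div_of_pos (by norm_num)]
      simp
    rw [alg.policyLaw_toOuterMeasure, h3, ENNReal.ofReal_lt_ofReal_iff (by norm_num)] at h
    exact h
  have : Nonempty (Fin m) := ⟨⟨0, hm⟩⟩
  obtain ⟨k, hk⟩ := alg.exists_change_of_measure φ (fun q => κ q.1 q.2) (M₀ := M θ₀ hθ₀)
    (M₁ := fun k => M (θ₁ k) (hθ₁ k)) (fun _ => rfl) hd0 hd1 (fun k q f => by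
      split_ifs with hq
      · have e1 : θ₁ k (κ q.1 q.2) = γ + D := if_pos hq
        refine sq_weighted_sum_selfLoop_le hd0 hd1 q.1 q.2 f ?_ ?_ ?_ <;> rw [e1]
        · simp only [θ₀]; linarith
        · linarith
        · simp only [θ₀]
          rw [show γ + D - (γ - D) = 2 * D by ring, hDd]
          refine mul_le_mul_of_nonneg_left ?_ hd0
          exact mul_le_mul (by linarith) (by linarith) (by linarith) hhi.1
      · have e1 : θ₁ k (κ q.1 q.2) = γ - D := if_neg hq
        -- Off label `k` the parameters coincide, so the divergence is `0`.
        have := sq_weighted_sum_selfLoop_le (y := y) (hμ := hμ) (hr := hr) (hγ := hγ) (hθ₀ := hθ₀)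
          (hθ₁ := hθ₁ k) le_rfl zero_le_one q.1 q.2 f (by rw [e1]) (by rw [e1]; linarith)
          (by rw [e1]; simp [θ₀])
        rwa [sub_zero] at this) N
  have hdN : d * (N / Fintype.card (Fin m)) ≤ 2 / 25 := by
    refine le_trans (mul_le_mul_of_nonneg_left ?_ hd0) hN
    have hm' : (0 : ℝ) < m := Nat.cast_pos.2 hm
    have hK' : (0 : ℝ) < K := Nat.cast_pos.2 (by omega)
    have hKm' : (K : ℝ) ≤ 4 * m := by exact_mod_cast hKm
    rw [Fintype.card_fin, div_le_div_iff₀ hm' hK']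
    nlinarith [Nat.cast_nonneg (α := ℝ) N]
  let B : Set (S → A) := {π | π (x k) ≠ a k}
  have hB₀ := hcon θ₀ hθ₀ Bᶜ fun π hπ => hbad₀ k π (not_not.1 hπ)
  have hB₁ := hcon (θ₁ k) (hθ₁ k) B fun π hπ => hbad₁ k π hπ
  have hadd : alg.expectation (M θ₀ hθ₀) φ N (alg.outputProb (M θ₀ hθ₀) φ B) +
      alg.expectation (M θ₀ hθ₀) φ N (alg.outputProb (M θ₀ hθ₀) φ Bᶜ) = 1 := by
    rw [← SamplingAlgorithm.expectation_add]
    simp only [SamplingAlgorithm.outputProb_add_compl, SamplingAlgorithm.expectation_const]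
  have := hk B (by linarith)
  -- `(2/3 - 2/25)² = (44/75)²` exceeds `1/3`.
  nlinarith

theorem theorem1 :
    ∃ c : ℝ, 0 < c ∧ ∀ γ₀ : ℝ, 0 < γ₀ → γ₀ < 1 → ∃ ε₀ : ℝ, 0 < ε₀ ∧ ε₀ < 1 ∧
      ∀ (S A : Type*) [Fintype S] [Fintype A], 2 ≤ Fintype.card S → 2 ≤ Fintype.card A →
      ∀ K : ℕ, 2 ≤ K → K ≤ Fintype.card S * Fintype.card A →
      ∀ γ : ℝ, γ₀ ≤ γ → γ < 1 →
      ∀ ε : ℝ, 0 < ε → ε ≤ ε₀ →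
      ∀ N : ℕ, (N : ℝ) ≤ c * (K / ((1 - γ) ^ 3 * ε ^ 2 * Real.log (1 / ε))) →
      ∀ alg : SamplingAlgorithm S A K,
        ∃ φ : S → A → Fin K → ℝ, ∃ M ∈ DMDP.featureClass γ φ,
          1 / 3 ≤ (alg.policyLaw M φ N).toOuterMeasure {π | ε < M.subopt π} := by
  -- This `ε₀` forces `log (1 / ε) ≥ 640000 / γ³`, where `640000 * (2 / 25) = 4 * 12800`; hence `c =
  -- 1` suffices.
  refine ⟨1, one_pos, fun γ₀ hγ₀ hγ₀' => ⟨Real.exp (-(640000 / γ₀ ^ 3)), Real.exp_pos _,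
    Real.exp_lt_one_iff.2 (neg_lt_zero.2 (by positivity)), ?_⟩⟩
  intro S A _ _ hS hA K hK hKSA γ hγ₀γ hγ1 ε hε hεε₀ N hN alg
  have hγ0 : 0 < γ := hγ₀.trans_le hγ₀γ
  have hβ : 0 < 1 - γ := by linarith
  have hL : 640000 / γ ^ 3 ≤ Real.log (1 / ε) := by
    have h1 : Real.log ε ≤ -(640000 / γ₀ ^ 3) := (Real.log_le_iff_le_exp hε).2 hεε₀
    rw [one_div, Real.log_inv]
    have h2 : 640000 / γ ^ 3 ≤ 640000 / γ₀ ^ 3 := by gcongr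
    linarith
  have hLpos : 0 < Real.log (1 / ε) := lt_of_lt_of_le (by positivity) hL
  have hεγ : 640000 * ε ≤ γ ^ 3 := by
    have h1 : Real.log (1 / ε) ≤ 1 / ε := (Real.log_le_self (by positivity))
    have h2 := hL.trans h1
    rwa [div_le_div_iff₀ (by positivity) hε, one_mul] at h2
  have hγ3 : γ ^ 3 ≤ γ ^ 2 := pow_le_pow_of_le_one hγ0.le hγ1.le (by norm_num)
  have hγ2 : γ ^ 2 ≤ γ := by nlinarith
  have hβ2 : (1 - γ) ^ 2 ≤ 1 - γ := by nlinarith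
  refine alg.exists_instance_subopt_gt hS hA hK hKSA ⟨hγ0, hγ1⟩ hε ?_ ?_ ?_ ?_
  · rw [div_le_iff₀ hγ0]
    calc 40 * ε * (1 - γ) ^ 2 ≤ 40 * ε * (1 - γ) := by gcongr
      _ ≤ γ / 2 * (1 - γ) := by gcongr; linarith
      _ = _ := by ring
  · rw [div_le_iff₀ hγ0]
    calc 40 * ε * (1 - γ) ^ 2 ≤ 40 * ε * 1 := by gcongr; linarith
      _ ≤ γ * γ := by linarith
  · rw [div_le_one (by positivity)]
    have hε1 : ε ≤ 1 := by linarith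
    have h1 : (1 - γ) ^ 3 ≤ 1 := pow_le_one₀ hβ.le (by linarith)
    calc 12800 * ε ^ 2 * (1 - γ) ^ 3 ≤ 12800 * ε ^ 2 * 1 := by gcongr
      _ ≤ 12800 * ε := by nlinarith
      _ ≤ γ ^ 3 := by linarith
  · have hK' : (0 : ℝ) < K := Nat.cast_pos.2 (by omega)
    rw [one_mul] at hN
    calc 12800 * ε ^ 2 * (1 - γ) ^ 3 / γ ^ 3 * (4 * N / K)
        ≤ 12800 * ε ^ 2 * (1 - γ) ^ 3 / γ ^ 3 *
          (4 * (K / ((1 - γ) ^ 3 * ε ^ 2 * Real.log (1 / ε))) / K) := by gcongr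
      _ = 51200 / γ ^ 3 / Real.log (1 / ε) := by field_simp; ring
      _ ≤ 2 / 25 := by
          rw [div_le_iff₀ hLpos]
          have : 51200 / γ ^ 3 = 2 / 25 * (640000 / γ ^ 3) := by ring
          rw [this]
          gcongr
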